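/- **Theorem.** Let $\chi\colon\mathbb Z\to\{0,1,-1\}$ be periodic with period $M\ge 1$ and mean value zero. Put $\psi_u(x)=1$ if $x\equiv u\pmod M$ and $\psi_u(x)=0$ otherwise. Assume that $\chi$ is *good*, that is, $\chi$ is a finite sum of functions $\psi_u-\psi_v$ for which there is a natural number $C$ with $\gcd(C,M)=1$ and $uC\equiv v\pmod M$. Let $p$ be a prime with $p\nmid M$. Let $a,b\in\mathbb Z$, $b\neq0$, be such that $$P_{a,b,\chi}(q):=\sum_{n\ge0}n\,\chi(n)\,q^{\frac{n^2-a^2}{b}}\in\mathbb Z[[q]].$$ Then there is exactly one sequence $H_{a,b,\chi}(n)$, $n\ge0$, of real numbers such that, as $t\to0^+$, $$P_{a,b,\chi}(e^{-t})\sim\sum_{n\ge0}H_{a,b,\chi}(n)\,(1-e^{-t})^n ,$$ meaning that for every $N\ge0$ the difference of the left side and the sum over $n<N$ is $O(t^N)$; all $H_{a,b,\chi}(n)$ are rational. Let $$S^*=\Big\{s\in\{0,\dots,p-1\}:\ \exists\,x\in\operatorname{supp}(\chi),\ \tfrac{x^2-a^2}{b}\equiv s\pmod p\Big\},$$ $$S=\Big\{s\in\{0,\dots,p-1\}:\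 \exists\,x\in\operatorname{supp}(\chi),\ p\nmid x,\ \tfrac{x^2-a^2}{b}\equiv s\pmod p\Big\},$$ where $\operatorname{supp}(\chi)=\{x\in\mathbb Z:\chi(x)\ne0\}$ and $\max\emptyset:=0$. For rational $r$, write $r\equiv0\pmod{p^A}$ if $r=p^Au/v$ with $u,v\in\mathbb Z$ and $p\nmid v$. 1. If $B\in\{1,2,\dots,p-1-\max S^*\}$, then for all integers $n,A\ge1$, $$H_{a,b,\chi}(p^An-B)\equiv0\pmod{p^A}.$$ 2. Suppose that $p\nmid b$, and that the coefficient $\beta$ of $p^1$ in the base $p$ expansion of the $p$-adic integer $-a^2/b$ is not $p-1$. If $B\in\{1,2,\dots,p-1-\max S\}$, then for all integers $n,A\ge1$, $$H_{a,b,\chi}(p^An-B)\equiv0\pmod{p^A}.$$ -/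

import Mathlib

open Filter Topology Asymptotics

noncomputable section

/-- `ψ_u`: the indicator function of the residue class of `u` modulo `M`. -/
def psi (M : ℕ) (u x : ℤ) : ℤ :=
  open scoped Classical in if x ≡ u [ZMOD (M : ℤ)] then 1 else 0

/-- `ψ_{u,v} = ψ_u - ψ_v`. -/
def psiDiff (M : ℕ) (u v x : ℤ) : ℤ := psi M u x - psi M v x

/-- `χ : ℤ → {0, 1, -1}`, periodic with period `M` and of mean value zero, is a good function:
it is a finite sum of functions `ψ_{u,v}` such that `u * C ≡ v (mod M)` for some natural number
`C` coprime to `M`. -/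
structure IsGood (M : ℕ) (χ : ℤ → ℤ) : Prop where
  period_pos : 0 < M
  values : ∀ x, χ x = 0 ∨ χ x = 1 ∨ χ x = -1
  periodic : Function.Periodic χ (M : ℤ)
  mean_zero : ∑ x ∈ Finset.range M, χ (x : ℤ) = 0
  sum_psiDiff : ∃ l : List (ℤ × ℤ),
    (∀ w ∈ l, ∃ C : ℕ, 0 < C ∧ Nat.Coprime C M ∧ w.1 * (C : ℤ) ≡ w.2 [ZMOD (M : ℤ)]) ∧
    ∀ x, χ x = (l.map fun w => psiDiff M w.1 w.2 x).sum

/-- The coefficient of `q ^ r` (`r` rational) in the formal series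
`P_{a,b,χ}(q) = ∑_{n ≥ 0} n χ(n) q ^ ((n ^ 2 - a ^ 2) / b)`. For `b ≠ 0` the exponents belonging
to distinct `n` are distinct, so at most one `n` contributes. -/
def partialThetaCoeff (a b : ℤ) (χ : ℤ → ℤ) (r : ℚ) : ℤ :=
  ∑ᶠ (n : ℕ) (_ : ((n : ℚ) ^ 2 - (a : ℚ) ^ 2) / (b : ℚ) = r), (n : ℤ) * χ (n : ℤ)

/-- `P_{a,b,χ} ∈ ℤ[[q]]`: only exponents that are nonnegative integers occur (the coefficients
are integers by definition). -/
def PartialThetaIntegral (a b : ℤ) (χ : ℤ → ℤ) : Prop :=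
  ∀ r : ℚ, partialThetaCoeff a b χ r ≠ 0 → ∃ k : ℕ, r = (k : ℚ)

/-- The value of `P_{a,b,χ}` at a real number `q ∈ (0, 1)`. -/
def partialTheta (a b : ℤ) (χ : ℤ → ℤ) (q : ℝ) : ℝ :=
  ∑' n : ℕ, (n : ℝ) * (χ (n : ℤ) : ℝ) * q ^ (((n : ℝ) ^ 2 - (a : ℝ) ^ 2) / (b : ℝ))

/-- The asymptotic expansion
`P_{a,b,χ}(e ^ (-t)) ∼ ∑_{n ≥ 0} c(n) (1 - e ^ (-t)) ^ n` as `t → 0⁺`, in the sense of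
Poincaré. -/
def HasExpansion (a b : ℤ) (χ : ℤ → ℤ) (c : ℕ → ℝ) : Prop :=
  ∀ N : ℕ,
    (fun t : ℝ => partialTheta a b χ (Real.exp (-t)) -
      ∑ n ∈ Finset.range N, c n * (1 - Real.exp (-t)) ^ n) =O[𝓝[>] (0 : ℝ)] fun t : ℝ => t ^ N

/-- `S*`: the residues `0 ≤ s < p` of the integers `y = (x ^ 2 - a ^ 2) / b`, where `x` runs
over the support of `χ`. -/
def residuesStar (a b : ℤ) (χ : ℤ → ℤ) (p : ℕ) : Set ℕ :=
  {s | s < p ∧ ∃ x : ℤ, χ x ≠ 0 ∧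
    ∃ y : ℤ, b * y = x ^ 2 - a ^ 2 ∧ y ≡ (s : ℤ) [ZMOD (p : ℤ)]}

/-- `S`: the same residues with `x` restricted to the elements of the support of `χ` that are
not divisible by `p`. -/
def residues (a b : ℤ) (χ : ℤ → ℤ) (p : ℕ) : Set ℕ :=
  {s | s < p ∧ ∃ x : ℤ, χ x ≠ 0 ∧ ¬ (x ≡ 0 [ZMOD (p : ℤ)]) ∧
    ∃ y : ℤ, b * y = x ^ 2 - a ^ 2 ∧ y ≡ (s : ℤ) [ZMOD (p : ℤ)]}

/-- `β`: the coefficient of `p ^ 1` in the base `p` expansion of the `p`-adic integer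
`-a ^ 2 / b`, for `b` prime to `p`. The least nonnegative residue of `-a ^ 2 / b` modulo `p ^ 2`
is `d₀ + d₁ p` with digits `d₀, d₁ < p`, and its quotient by `p` is `d₁`. -/
def betaDigit (p : ℕ) (a b : ℤ) : ℕ :=
  (-(a : ZMod (p ^ 2)) ^ 2 * (b : ZMod (p ^ 2))⁻¹).val / p

/-- The congruence `r ≡ 0 (mod p ^ A)` for a rational number `r`: it says that
`r = p ^ A * u / v` with integers `u, v` and `v` not divisible by `p`. -/
def CongrZero (p A : ℕ) (r : ℚ) : Prop :=
  ∃ u v : ℤ, ¬ ((p : ℤ) ∣ v) ∧ r * (v : ℚ) = (p : ℚ) ^ A * (u : ℚ)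

end

/-! Everything rests on a closed form: H(n) is (-1)^n / M^K times a finite integer combination of
the numbers j * choose((j^2 - a^2)/b, n).

To get it, take the generating series S of χ. Mean zero makes S times Φ = 1 + X + ... + X^(M-1) a
polynomial, and Φ ≡ M modulo X - 1, so M^K S = W + G (X - 1)^K with W a polynomial and G of bounded
coefficients (`exists_pow_mul_mk_eq`). Pairing with f(n) = n q^((n^2 - a^2)/b), the factor (X - 1)^K
becomes a K-fold difference of f. Each difference gains √t and summation costs a fixed t^(-3/2), so
K = 2N + 3 leaves an error O(t^N). The finite part W is expanded by the binomial series of (1 - (1 -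
q))^y.

For the congruence each summand is treated in ℤ_p, with y = (j^2 - a^2)/b. The product (y+1)...(y+B)
* choose(y, p^A n - B) is divisible by p^A (`PadicInt.pow_dvd_mul_choose`), so it suffices that
(y+1)...(y+B) divides j. As p ∤ M, the support of χ meets every class modulo p, hence y mod p lies
in S*, and max S* + B < p makes all factors units. In the second claim this covers p ∤ j; for p ∣ j
at most one factor is a nonunit, the condition on β keeps p^2 from dividing it, and the factor p of
j absorbs it. -/

/-! ### Divisibility of binomial coefficients in ℤ_p -/

theorem prod_dvd_of_isUnit_of_ne {R ι : Type*} [CommRing R] [DecidableEq ι] (s : Finset ι)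
    (f : ι → R) (c : R) (i₀ : ι) (hu : ∀ i ∈ s, i ≠ i₀ → IsUnit (f i))
    (hd : i₀ ∈ s → f i₀ ∣ c) : ∏ i ∈ s, f i ∣ c := by
  by_cases h : i₀ ∈ s
  · rw [← Finset.mul_prod_erase s f h]
    have : IsUnit (∏ i ∈ s.erase i₀, f i) :=
      IsUnit.prod_iff.2 fun i hi => hu i (Finset.mem_of_mem_erase hi) (Finset.ne_of_mem_erase hi)
    exact (this.mul_right_dvd).2 (hd h)
  · exact (IsUnit.prod_iff.2 fun i hi => hu i hi fun e => h (e ▸ hi)).dvd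

/-- The product is a falling factorial whose first factor is p^A n. -/
theorem pow_dvd_choose_mul_factorial (p A n B : ℕ) (hB : 0 < B) :
    p ^ A ∣ (p ^ A * n).choose B * B.factorial := by
  rw [mul_comm, ← Nat.descFactorial_eq_factorial_mul_choose]
  obtain ⟨k, rfl⟩ := Nat.exists_eq_succ_of_ne_zero hB.ne'
  rcases Nat.eq_zero_or_pos (p ^ A * n) with h | h
  · simp [h]
  · obtain ⟨m, hm⟩ := Nat.exists_eq_succ_of_ne_zero h.ne'
    rw [hm, Nat.succ_descFactorial_succ, ← Nat.succ_eq_add_one, ← hm]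
    exact Dvd.dvd.mul_right (Dvd.intro _ rfl) _

theorem descPochhammer_smeval_eq_prod {R : Type*} [CommRing R] (r : R) (n : ℕ) :
    (descPochhammer ℤ n).smeval r = ∏ i ∈ Finset.range n, (r - i) := by
  induction n with
  | zero => simp
  | succ n ih =>
    rw [Finset.prod_range_succ, ← ih]
    simp [descPochhammer_succ_right, Polynomial.smeval_mul, Polynomial.smeval_sub,
      Polynomial.smeval_natCast]

/-- If `(y + 1) ⋯ (y + B)` divides `x`, then `p ^ A` divides `x * choose y (p ^ A * n - B)`. -/
theorem PadicInt.pow_dvd_mul_choose {p : ℕ} [Fact p.Prime] (x y : ℤ_[p]) (A n B : ℕ)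
    (hB : 0 < B) (hBn : B ≤ p ^ A * n)
    (hx : ∏ i ∈ Finset.range B, (y + B - i) ∣ x) :
    (p : ℤ_[p]) ^ A ∣ x * Ring.choose y (p ^ A * n - B) := by
  -- Trinomial revision: choose(p^A n, B) choose(y+B, p^A n) = choose(y+B, B) choose(y, p^A n - B).
  have h1 := Ring.choose_smul_choose (y + B) hBn
  have h2 := Ring.descPochhammer_eq_factorial_smul_choose (y + B) B
  rw [descPochhammer_smeval_eq_prod] at h2
  rw [add_sub_cancel_right] at h1
  have h3 : ((p ^ A : ℕ) : ℤ_[p]) ∣ ((p ^ A * n).choose B * B.factorial : ℕ) :=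
    Nat.cast_dvd_cast (pow_dvd_choose_mul_factorial p A n B hB)
  have h4 : (p : ℤ_[p]) ^ A ∣
      (∏ i ∈ Finset.range B, (y + B - i)) * Ring.choose y (p ^ A * n - B) := by
    rw [h2, nsmul_eq_mul, mul_assoc, ← h1, nsmul_eq_mul]
    push_cast at h3
    rw [← mul_assoc, mul_comm (B.factorial : ℤ_[p])]
    exact h3.mul_right _
  exact h4.trans (mul_dvd_mul_right hx _)

theorem PadicInt.isUnit_intCast_iff {p : ℕ} [hp : Fact p.Prime] (k : ℤ) :
    IsUnit (k : ℤ_[p]) ↔ ¬ (p : ℤ) ∣ k := by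
  rw [← not_iff_not, not_not, PadicInt.not_isUnit_iff, PadicInt.norm_int_lt_one_iff_dvd]

theorem PadicInt.intCast_dvd_p {p : ℕ} [hp : Fact p.Prime] (k : ℤ) (hk : ¬ (p : ℤ) ^ 2 ∣ k) :
    (k : ℤ_[p]) ∣ (p : ℤ_[p]) := by
  by_cases h : (p : ℤ) ∣ k
  · obtain ⟨l, rfl⟩ := h
    have : IsUnit (l : ℤ_[p]) := by
      rw [PadicInt.isUnit_intCast_iff]
      rintro ⟨m, rfl⟩
      exact hk ⟨m, by ring⟩
    push_cast
    rw [this.mul_right_dvd]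
  · exact ((PadicInt.isUnit_intCast_iff k).2 h).dvd

theorem PadicInt.pow_dvd_mul_choose_of_int {p : ℕ} [Fact p.Prime] {u b : ℤ} {y : ℤ_[p]}
    (hb : ¬ (p : ℤ) ∣ b) (hy : b * y = u) (x : ℤ) (A n B : ℕ)
    (hB : 0 < B) (hBn : B ≤ p ^ A * n)
    (h : (∀ i : ℕ, 0 < i → i ≤ B → ¬ (p : ℤ) ∣ u + b * i) ∨
      ((p : ℤ) ∣ x ∧ ∃ i₀ : ℕ, (∀ i : ℕ, 0 < i → i ≤ B → i ≠ i₀ → ¬ (p : ℤ) ∣ u + b * i) ∧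
        ¬ (p : ℤ) ^ 2 ∣ u + b * i₀)) :
    (p : ℤ_[p]) ^ A ∣ x * Ring.choose y (p ^ A * n - B) := by
  apply PadicInt.pow_dvd_mul_choose _ _ _ _ _ hB hBn
  -- After reversal the factor of index i is y + (i + 1), which b turns into the integer u + b(i +
  -- 1).
  rw [← Finset.prod_range_reflect]
  have hbu := (PadicInt.isUnit_intCast_iff b).2 hb
  have key : ∀ i ∈ Finset.range B,
      (b : ℤ_[p]) * (y + B - ((B - 1 - i : ℕ) : ℤ_[p])) = ((u + b * (i + 1 : ℕ) : ℤ) : ℤ_[p]) := by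
    intro i hi
    rw [Finset.mem_range] at hi
    rw [show B - 1 - i = B - (i + 1) by omega, Nat.cast_sub (by omega)]
    push_cast
    rw [← hy]; ring
  have unit : ∀ i ∈ Finset.range B, ¬ (p : ℤ) ∣ u + b * (i + 1 : ℕ) →
      IsUnit (y + B - ((B - 1 - i : ℕ) : ℤ_[p])) := by
    intro i hi h
    rw [← PadicInt.isUnit_intCast_iff, ← key i hi] at h
    exact isUnit_of_mul_isUnit_right h
  rcases h with h | ⟨hx, i₀, h1, h2⟩
  · exact (IsUnit.prod_iff.2 fun i hi => unit i hi
      (h _ (by omega) (by rw [Finset.mem_range] at hi; omega))).dvd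
  · have hx' : (p : ℤ_[p]) ∣ (x : ℤ_[p]) := by
      simpa using (PadicInt.pow_p_dvd_int_iff 1 x).2 (by simpa using hx)
    refine dvd_trans ?_ hx'
    -- The factors are y + 1, ..., y + B, so i₀ = 0 excludes none of them.
    rcases Nat.eq_zero_or_pos i₀ with h0 | h0
    · exact (IsUnit.prod_iff.2 fun i hi => unit i hi
        (h1 _ (by omega) (by rw [Finset.mem_range] at hi; omega) (by omega))).dvd
    · refine prod_dvd_of_isUnit_of_ne _ _ _ (i₀ - 1) ?_ ?_
      · intro i hi hne
        exact unit i hi (h1 _ (by omega) (by rw [Finset.mem_range] at hi; omega) (by omega))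
      · intro hi
        rw [← hbu.mul_left_dvd, key _ hi, show i₀ - 1 + 1 = i₀ by omega]
        exact PadicInt.intCast_dvd_p _ h2

/-- A p-adically integral rational has denominator prime to p, so its numerator carries the whole
power of p. -/
theorem CongrZero.of_padic {p : ℕ} [hp : Fact p.Prime] {A : ℕ} {r : ℚ} {z : ℤ_[p]}
    (h : (r : ℚ_[p]) = (p : ℚ_[p]) ^ A * z) : CongrZero p A r := by
  have hn : ‖(r : ℚ_[p])‖ ≤ (p : ℝ) ^ (-A : ℤ) := by
    rw [h, norm_mul, norm_pow, Padic.norm_p]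
    simpa using mul_le_mul_of_nonneg_left (PadicInt.norm_le_one z)
      (by positivity : (0 : ℝ) ≤ ((p : ℝ)⁻¹) ^ A)
  have hle : ‖(r : ℚ_[p])‖ ≤ 1 := by
    refine hn.trans ?_
    rw [zpow_neg, zpow_natCast]
    exact inv_le_one_of_one_le₀ (one_le_pow₀ (by exact_mod_cast hp.out.one_lt.le))
  have hu := PadicInt.isUnit_den r hle
  have hden : ‖((r.den : ℤ) : ℚ_[p])‖ = 1 := by
    have := PadicInt.isUnit_iff.1 hu
    simpa [PadicInt.norm_def] using this
  have hnum : ((r.num : ℤ) : ℚ_[p]) = r * ((r.den : ℤ) : ℚ_[p]) := by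
    exact_mod_cast (Rat.mul_den_eq_num r).symm
  have hdvd : ((p : ℤ) ^ A) ∣ r.num := by
    rw [← Padic.norm_int_le_pow_iff_dvd, hnum, norm_mul, hden, mul_one]
    exact hn
  obtain ⟨u, hu'⟩ := hdvd
  refine ⟨u, r.den, ?_, ?_⟩
  · rw [← PadicInt.isUnit_intCast_iff]; simpa using hu
  · have := Rat.mul_den_eq_num r
    push_cast at *
    rw [this, hu']
    push_cast; ring

/-- Passage from ℤ_p to ℚ: b and D are units in ℤ_p, and `Ring.choose` commutes with the maps of ℚ
and ℤ_p into ℚ_p. -/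
theorem CongrZero.sum_choose {p : ℕ} [hp : Fact p.Prime] {ι : Type*} (s : Finset ι)
    (b : ℤ) (hb : ¬ (p : ℤ) ∣ b) (u x w : ι → ℤ) (N A : ℕ) (D : ℕ) (hD : Nat.Coprime p D)
    (h : ∀ i ∈ s, ∀ y : ℤ_[p], b * y = u i → (p : ℤ_[p]) ^ A ∣ x i * Ring.choose y N) :
    CongrZero p A ((-1) ^ N / D * ∑ i ∈ s, w i * (x i * Ring.choose ((u i : ℚ) / b) N)) := by
  have hbu := (PadicInt.isUnit_intCast_iff (p := p) b).2 hb
  have hDu : IsUnit ((D : ℤ) : ℤ_[p]) := by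
    rw [PadicInt.isUnit_intCast_iff, Int.natCast_dvd_natCast]
    exact fun h => (hp.out.coprime_iff_not_dvd.1 hD) h
  obtain ⟨D', hD'⟩ := hDu.exists_right_inv
  choose y hy using fun i => hbu.dvd (a := ((u i : ℤ) : ℤ_[p]))
  choose! z hz using fun i hi => h i hi (y i) (hy i).symm
  apply CongrZero.of_padic (z := (-1) ^ N * D' * ∑ i ∈ s, w i * z i)
  have hb0 : (b : ℚ_[p]) ≠ 0 := by
    rintro e; apply hb; have : b = 0 := by exact_mod_cast e
    simp [this]
  have hcomm : ∀ i, ((Ring.choose ((u i : ℚ) / b) N : ℚ) : ℚ_[p]) =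
      ((Ring.choose (y i) N : ℤ_[p]) : ℚ_[p]) := by
    intro i
    have h1 := Ring.map_choose (Rat.castHom ℚ_[p]) ((u i : ℚ) / b) N
    have h2 := Ring.map_choose (PadicInt.Coe.ringHom (p := p)) (y i) N
    have h3 : (Rat.castHom ℚ_[p]) ((u i : ℚ) / b) = PadicInt.Coe.ringHom (p := p) (y i) := by
      have := congrArg (PadicInt.Coe.ringHom (p := p)) (hy i)
      simp at this ⊢
      rw [this]; field_simp
    rw [h3] at h1
    exact h1.trans h2.symm
  have hDD : (D : ℚ_[p]) * D' = 1 := by exact_mod_cast congrArg (PadicInt.Coe.ringHom (p := p)) hD'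
  have hD0 : (D : ℚ_[p]) ≠ 0 := left_ne_zero_of_mul_eq_one hDD
  have hDe : (D' : ℚ_[p]) = (D : ℚ_[p])⁻¹ := by field_simp; rw [mul_comm]; exact hDD
  have hsum : ((∑ i ∈ s, w i * (x i * Ring.choose ((u i : ℚ) / b) N) : ℚ) : ℚ_[p]) =
      (p : ℚ_[p]) ^ A * ((∑ i ∈ s, w i * z i : ℤ_[p]) : ℚ_[p]) := by
    have hz' : ((∑ i ∈ s, w i * z i : ℤ_[p]) : ℚ_[p]) = ∑ i ∈ s, (w i : ℚ_[p]) * z i := by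
      simp
    rw [hz']
    push_cast
    rw [Finset.mul_sum]
    refine Finset.sum_congr rfl fun i hi => ?_
    have hzi : (x i : ℚ_[p]) * ((Ring.choose (y i) N : ℤ_[p]) : ℚ_[p]) = (p : ℚ_[p]) ^ A * z i := by
      have := congrArg (PadicInt.Coe.ringHom (p := p)) (hz i hi)
      simp only [map_mul, map_pow, map_intCast, map_natCast] at this
      exact this
    rw [hcomm]
    linear_combination (w i : ℚ_[p]) * hzi
  rw [Rat.cast_mul, hsum]
  push_cast
  rw [hDe]; ring

/-! ### Expansions in powers of 1 - e^(-t) -/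

/-- The expansion in powers of a quantity tending to zero is unique. -/
theorem eq_zero_of_sum_mul_pow_isBigO {α : Type*} {l : Filter α} [l.NeBot] {w : α → ℝ}
    (hw : Tendsto w l (𝓝 0)) (hw0 : ∀ᶠ x in l, w x ≠ 0) (N : ℕ) (d : ℕ → ℝ)
    (h : (fun x => ∑ n ∈ Finset.range N, d n * w x ^ n) =O[l] fun x => w x ^ N) :
    ∀ n < N, d n = 0 := by
  induction N generalizing d with
  | zero => simp
  | succ N ih =>
    have h0 : d 0 = 0 := by
      have t1 : Tendsto (fun x => ∑ n ∈ Finset.range (N + 1), d n * w x ^ n) l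
          (𝓝 (∑ n ∈ Finset.range (N + 1), d n * 0 ^ n)) :=
        tendsto_finsetSum _ fun n _ => (hw.pow n).const_mul _
      have t2 : Tendsto (fun x => ∑ n ∈ Finset.range (N + 1), d n * w x ^ n) l (𝓝 0) :=
        h.trans_tendsto (by simpa using hw.pow (N + 1))
      have := tendsto_nhds_unique t1 t2
      simpa [Finset.sum_range_succ'] using this
    have h' : (fun x => ∑ n ∈ Finset.range N, d (n + 1) * w x ^ n) =O[l] fun x => w x ^ N := by
      have e : (fun x => ∑ n ∈ Finset.range (N + 1), d n * w x ^ n) =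
          fun x => w x * ∑ n ∈ Finset.range N, d (n + 1) * w x ^ n := by
        funext x
        rw [Finset.sum_range_succ', h0, Finset.mul_sum]
        simp only [zero_mul, add_zero]
        exact Finset.sum_congr rfl fun n _ => by ring
      rw [e] at h
      obtain ⟨C, hC⟩ := h.bound
      refine IsBigO.of_bound C ?_
      filter_upwards [hC, hw0] with x hx hx0
      rw [norm_mul, pow_succ', norm_mul, ← mul_assoc, mul_comm C, mul_assoc] at hx
      exact le_of_mul_le_mul_left hx (norm_pos_iff.2 hx0)
    intro n hn
    cases n with
    | zero => exact h0
    | succ n => exact ih _ h' n (by omega)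

theorem one_sub_exp_neg_tendsto :
    Tendsto (fun t : ℝ => 1 - Real.exp (-t)) (𝓝[>] 0) (𝓝 0) := by
  have : Continuous fun t : ℝ => 1 - Real.exp (-t) := by fun_prop
  have h := (this.tendsto 0).mono_left (nhdsWithin_le_nhds (s := Set.Ioi 0))
  simpa using h

theorem one_sub_exp_neg_isTheta :
    (fun t : ℝ => 1 - Real.exp (-t)) =Θ[𝓝[>] 0] fun t => t := by
  have hd : HasDerivAt (fun t : ℝ => 1 - Real.exp (-t)) 1 0 := by
    have := ((hasDerivAt_neg (0 : ℝ)).exp).const_sub 1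
    simpa using this
  have e : (fun t : ℝ => 1 - Real.exp (-t)) ~[𝓝[>] 0] fun t => t := by
    have h := hd.isLittleO
    simp only [neg_zero, Real.exp_zero, sub_self, sub_zero, smul_eq_mul, mul_one] at h
    exact h.mono nhdsWithin_le_nhds
  exact e.isTheta

theorem exp_neg_mul_sub_binomial_isBigO (y : ℝ) (N : ℕ) :
    (fun t : ℝ => Real.exp (-(t * y)) -
      ∑ n ∈ Finset.range N, (-1) ^ n * Ring.choose y n * (1 - Real.exp (-t)) ^ n)
      =O[𝓝[>] 0] fun t => t ^ N := by
  have h := (Real.one_add_rpow_hasFPowerSeriesAt_zero (a := y)).isBigO_sub_partialSum_pow N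
  have ht : Tendsto (fun t : ℝ => -(1 - Real.exp (-t))) (𝓝[>] 0) (𝓝 0) := by
    simpa using one_sub_exp_neg_tendsto.neg
  have h2 := h.comp_tendsto ht
  have h3 : (fun t : ℝ => ‖-(1 - Real.exp (-t))‖ ^ N) =O[𝓝[>] 0] fun t => t ^ N := by
    have := one_sub_exp_neg_isTheta.1.neg_left.norm_left.pow N
    exact this
  refine (IsBigO.trans h2 h3).congr_left fun t => ?_
  simp only [Function.comp, zero_add, FormalMultilinearSeries.partialSum, binomialSeries_apply,
    List.ofFn_const, List.prod_replicate, smul_eq_mul]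
  congr 1
  · rw [show 1 + -(1 - Real.exp (-t)) = Real.exp (-t) by ring, ← Real.exp_mul]
    ring_nf
  · refine Finset.sum_congr rfl fun n _ => ?_
    rw [neg_pow]; ring

/-! ### Finite differences of the theta terms -/

theorem abs_eval_mul_exp_neg_sq_le (P : Polynomial ℝ) :
    ∃ C, 0 ≤ C ∧ ∀ x : ℝ, |P.eval x * Real.exp (-x ^ 2)| ≤ C := by
  induction P using Polynomial.induction_on' with
  | add p q hp hq =>
    obtain ⟨C, hC0, hC⟩ := hp
    obtain ⟨D, hD0, hD⟩ := hq
    refine ⟨C + D, by positivity, fun x => ?_⟩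
    rw [Polynomial.eval_add, add_mul]
    exact (abs_add_le _ _).trans (add_le_add (hC x) (hD x))
  | monomial n a =>
    refine ⟨|a| * (1 + n.factorial), by positivity, fun x => ?_⟩
    rw [Polynomial.eval_monomial, mul_assoc, abs_mul, abs_mul, abs_pow, Real.abs_exp]
    refine mul_le_mul_of_nonneg_left ?_ (abs_nonneg _)
    rw [Real.exp_neg, ← div_eq_mul_inv, div_le_iff₀ (Real.exp_pos _)]
    have h1 : |x| ^ n ≤ 1 + (x ^ 2) ^ n := by
      rw [← sq_abs, ← pow_mul, mul_comm 2 n, pow_mul]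
      nlinarith [sq_nonneg (|x| ^ n - 1), sq_nonneg (|x| ^ n)]
    have h2 := Real.pow_div_factorial_le_exp (x ^ 2) (sq_nonneg x) n
    rw [div_le_iff₀ (by positivity)] at h2
    have h3 := Real.one_le_exp (sq_nonneg x)
    linarith

theorem abs_eval_mul_exp_neg_sq_le_div (P : Polynomial ℝ) :
    ∃ C, 0 ≤ C ∧ ∀ x : ℝ, |P.eval x * Real.exp (-x ^ 2)| ≤ C / (1 + x ^ 2) := by
  obtain ⟨C, hC0, hC⟩ := abs_eval_mul_exp_neg_sq_le (P * (1 + Polynomial.X ^ 2))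
  refine ⟨C, hC0, fun x => ?_⟩
  rw [le_div_iff₀ (by positivity)]
  have := hC x
  simp only [Polynomial.eval_mul, Polynomial.eval_add, Polynomial.eval_one, Polynomial.eval_pow,
    Polynomial.eval_X] at this
  rw [mul_right_comm, abs_mul, abs_of_pos (by positivity : 0 < 1 + x ^ 2)] at this
  exact this

/-- The mean value inequality trades one difference for one derivative; induction applies it to the
differences of the family F. -/
theorem abs_fwdDiff_iter_le (K : ℕ) (F : ℕ → ℝ → ℝ)
    (hF : ∀ k x, HasDerivAt (F k) (F (k + 1) x) x) (x C : ℝ) (hC : ∀ y, x ≤ y → |F K y| ≤ C) :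
    |(fwdDiff 1)^[K] (F 0) x| ≤ C := by
  induction K generalizing F with
  | zero => exact hC x le_rfl
  | succ K ih =>
    rw [Function.iterate_succ_apply]
    refine ih (fun k => fwdDiff 1 (F k)) ?_ ?_
    · intro k y
      have h1 := (hF k (y + 1)).comp_add_const y 1
      exact h1.sub (hF k y)
    · intro y hy
      have := (convex_Ici x).norm_image_sub_le_of_norm_hasDerivWithin_le (f := F K)
        (f' := F (K + 1)) (C := C) (fun z _ => (hF K z).hasDerivWithinAt)
        (fun z hz => hC z hz) (x := y) (y := y + 1) hy (Set.mem_Ici.2 (le_add_of_le_of_nonneg hy zero_le_one))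
      simpa [fwdDiff] using this

theorem fwdDiff_iter_natCast (f : ℝ → ℝ) (K n : ℕ) :
    (fwdDiff 1)^[K] (fun m : ℕ => f m) n = (fwdDiff 1)^[K] f n := by
  induction K generalizing f with
  | zero => rfl
  | succ K ih =>
    rw [Function.iterate_succ_apply, Function.iterate_succ_apply, ← ih]
    have : (fwdDiff 1 fun m : ℕ => f m) = fun m : ℕ => fwdDiff 1 f m := by
      funext m
      simp [fwdDiff]
    rw [this]

/-- Successive derivatives of `P(x) exp(-x²)` divided by `exp(-x²)`. -/
noncomputable def gaussDeriv : ℕ → Polynomial ℝ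
  | 0 => Polynomial.X
  | k + 1 => (gaussDeriv k).derivative - 2 * Polynomial.X * gaussDeriv k

/-- The general term `n * q ^ ((n ^ 2 - a ^ 2) / b)`, `q = exp (-t)`, without the character. -/
noncomputable def thetaTerm (a b : ℤ) (t x : ℝ) : ℝ :=
  x * Real.exp (-(t * ((x ^ 2 - (a : ℝ) ^ 2) / b)))

theorem thetaTerm_fwdDiff_bound (a b : ℤ) (hb : 0 < b) (K : ℕ) :
    ∃ C, 0 ≤ C ∧ ∀ t : ℝ, 0 < t → t ≤ 1 → ∀ n : ℕ,
      |(fwdDiff 1)^[K] (fun m : ℕ => thetaTerm a b t m) n| ≤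
        C * (√(t / b) ^ K * (√(t / b) ^ 3)⁻¹) / (1 + (n : ℝ) ^ 2) := by
  obtain ⟨C, hC0, hC⟩ := abs_eval_mul_exp_neg_sq_le_div (gaussDeriv (K))
  have hbR : (1 : ℝ) ≤ b := by exact_mod_cast hb
  refine ⟨Real.exp ((a : ℝ) ^ 2 / b) * C, by positivity, fun t ht ht1 n => ?_⟩
  set ε := Real.sqrt (t / b) with hε
  have hε2 : ε ^ 2 = t / b := Real.sq_sqrt (by positivity)
  have hε0 : 0 < ε := Real.sqrt_pos.2 (by positivity)
  have hεt : ε ^ 2 ≤ t := by rw [hε2]; exact div_le_self ht.le hbR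
  set c := Real.exp (t * ((a : ℝ) ^ 2 / b)) with hc
  have hcle : c ≤ Real.exp ((a : ℝ) ^ 2 / b) :=
    Real.exp_le_exp.2 (mul_le_of_le_one_left (by positivity) ht1)
  -- The k-th derivative of the theta term: in the variable εx each differentiation yields a factor
  -- ε, and x = ε⁻¹(εx) costs one.
  let F : ℕ → ℝ → ℝ := fun k x =>
    c * ε⁻¹ * ε ^ k * ((gaussDeriv k).eval (ε * x) * Real.exp (-(ε * x) ^ 2))
  have hF0 : (fun x : ℝ => thetaTerm a b t x) = F 0 := by
    funext x
    have : Real.exp (-(t * ((x ^ 2 - (a : ℝ) ^ 2) / b))) = c * Real.exp (-(ε * x) ^ 2) := by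
      rw [hc, ← Real.exp_add, mul_pow, hε2]
      congr 1; ring
    simp only [thetaTerm, F, this, gaussDeriv, Polynomial.eval_X]
    field_simp
  have hF : ∀ k x, HasDerivAt (F k) (F (k + 1) x) x := by
    intro k x
    have h1 : HasDerivAt (fun x : ℝ => ε * x) ε x := by
      simpa using (hasDerivAt_id x).const_mul ε
    have h2 := ((gaussDeriv k).hasDerivAt (ε * x)).comp x h1
    have h3 := ((h1.pow 2).neg).exp
    have h4 := (h2.mul h3).const_mul (c * ε⁻¹ * ε ^ k)
    refine h4.congr_deriv ?_
    simp [F, gaussDeriv]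
    ring
  rw [fwdDiff_iter_natCast (fun x => thetaTerm a b t x), hF0]
  apply abs_fwdDiff_iter_le _ F hF
  intro y hy
  have hn : (0 : ℝ) ≤ n := Nat.cast_nonneg n
  have hy2 : (n : ℝ) ^ 2 ≤ y ^ 2 := pow_le_pow_left₀ hn hy 2
  have hε1 : ε ^ 2 ≤ 1 := hεt.trans ht1
  -- Making the majorant summable uniformly in t costs ε⁻², hence ε⁻³ in total.
  have hlow : ε ^ 2 * (1 + (n : ℝ) ^ 2) ≤ 1 + (ε * y) ^ 2 := by
    rw [mul_pow]; nlinarith [sq_nonneg ε]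
  have hcp : 0 < c := Real.exp_pos _
  calc |F K y|
      = c * (ε⁻¹ * ε ^ K) * |(gaussDeriv K).eval (ε * y) * Real.exp (-(ε * y) ^ 2)| := by
        simp only [F]
        rw [abs_mul, abs_of_pos (by positivity), mul_assoc c]
    _ ≤ c * (ε⁻¹ * ε ^ K) * (C / (ε ^ 2 * (1 + (n : ℝ) ^ 2))) := by
        gcongr
        exact (hC _).trans (by gcongr)
    _ = c * C * (ε ^ K * (ε ^ 3)⁻¹) / (1 + (n : ℝ) ^ 2) := by field_simp
    _ ≤ _ := by gcongr

theorem summable_inv_one_add_sq : Summable fun n : ℕ => (1 + (n : ℝ) ^ 2)⁻¹ := by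
  have h : Summable fun n : ℕ => ((n : ℝ) ^ 2)⁻¹ := Real.summable_nat_pow_inv.2 (by norm_num)
  refine (summable_nat_add_iff 1).1 (Summable.of_nonneg_of_le (fun n => by positivity) (fun n => ?_)
    ((summable_nat_add_iff 1).2 h))
  gcongr
  linarith

theorem thetaTerm_summable (a b : ℤ) (hb : 0 < b) (t : ℝ) (ht : 0 < t) (ht1 : t ≤ 1) :
    Summable fun n : ℕ => thetaTerm a b t n := by
  obtain ⟨C, -, hC⟩ := thetaTerm_fwdDiff_bound a b hb 0
  refine Summable.of_norm_bounded (g := fun n : ℕ =>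
    C * (√(t / b) ^ 0 * (√(t / b) ^ 3)⁻¹) * (1 + (n : ℝ) ^ 2)⁻¹)
    (summable_inv_one_add_sq.mul_left _) fun n => ?_
  simpa [div_eq_mul_inv] using hC t ht ht1 n

theorem tsum_abs_thetaTerm_fwdDiff_le (a b : ℤ) (hb : 0 < b) (N : ℕ) :
    ∃ C, ∀ t : ℝ, 0 < t → t ≤ 1 → ∀ (D : ℝ) (G : ℕ → ℝ), (∀ n, |G n| ≤ D) →
      |∑' n : ℕ, G n * (fwdDiff 1)^[2 * N + 3] (fun m : ℕ => thetaTerm a b t m) n| ≤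
        D * (C * t ^ N) := by
  obtain ⟨C, hC0, hC⟩ := thetaTerm_fwdDiff_bound a b hb (2 * N + 3)
  have hbR : (1 : ℝ) ≤ b := by exact_mod_cast hb
  refine ⟨C * ∑' n : ℕ, (1 + (n : ℝ) ^ 2)⁻¹, fun t ht ht1 D G hG => ?_⟩
  have hε : √(t / b) ^ (2 * N + 3) * (√(t / b) ^ 3)⁻¹ ≤ t ^ N := by
    have h0 : 0 < √(t / b) := Real.sqrt_pos.2 (by positivity)
    rw [pow_add, mul_inv_cancel_right₀ (by positivity), pow_mul, Real.sq_sqrt (by positivity)]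
    exact pow_le_pow_left₀ (by positivity) (div_le_self ht.le hbR) N
  have hb' : ∀ n : ℕ, ‖G n * (fwdDiff 1)^[2 * N + 3] (fun m : ℕ => thetaTerm a b t m) n‖ ≤
      D * (C * t ^ N) * (1 + (n : ℝ) ^ 2)⁻¹ := by
    intro n
    rw [norm_mul]
    have hD : 0 ≤ D := (abs_nonneg _).trans (hG n)
    rw [mul_assoc]
    refine mul_le_mul (hG n) ((hC t ht ht1 n).trans ?_) (norm_nonneg _) hD
    rw [div_eq_mul_inv]
    gcongr
  have := tsum_of_norm_bounded ((summable_inv_one_add_sq.mul_left (D * (C * t ^ N))).hasSum) hb'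
  rw [tsum_mul_left] at this
  calc _ ≤ _ := this
    _ = _ := by ring

/-! ### Summation by parts through power series -/

open PowerSeries in
/-- A power series with bounded integral coefficients. -/
def BoundedCoeff (G : PowerSeries ℤ) : Prop := ∃ C : ℝ, ∀ n, |((coeff n G : ℤ) : ℝ)| ≤ C

namespace BoundedCoeff

open PowerSeries

theorem add {G H : PowerSeries ℤ} (hG : BoundedCoeff G) (hH : BoundedCoeff H) :
    BoundedCoeff (G + H) := by
  obtain ⟨C, hC⟩ := hG
  obtain ⟨D, hD⟩ := hH
  refine ⟨C + D, fun n => ?_⟩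
  rw [map_add, Int.cast_add]
  exact (abs_add_le _ _).trans (add_le_add (hC n) (hD n))

theorem mul_X_pow {G : PowerSeries ℤ} (hG : BoundedCoeff G) (k : ℕ) : BoundedCoeff (G * X ^ k) := by
  obtain ⟨C, hC⟩ := hG
  refine ⟨C, fun n => ?_⟩
  rw [coeff_mul_X_pow']
  split_ifs
  · exact hC _
  · simpa using (abs_nonneg _).trans (hC 0)

theorem mul_C {G : PowerSeries ℤ} (hG : BoundedCoeff G) (a : ℤ) : BoundedCoeff (G * C a) := by
  obtain ⟨D, hD⟩ := hG
  refine ⟨D * |(a : ℝ)|, fun n => ?_⟩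
  rw [coeff_mul_C, Int.cast_mul, abs_mul]
  exact mul_le_mul_of_nonneg_right (hD n) (abs_nonneg _)

theorem mul_polynomial {G : PowerSeries ℤ} (hG : BoundedCoeff G) (P : Polynomial ℤ) :
    BoundedCoeff (G * (P : PowerSeries ℤ)) := by
  induction P using Polynomial.induction_on' with
  | add p q hp hq => rw [Polynomial.coe_add, mul_add]; exact hp.add hq
  | monomial n a =>
    rw [← Polynomial.C_mul_X_pow_eq_monomial, Polynomial.coe_mul, Polynomial.coe_C,
      Polynomial.coe_pow, Polynomial.coe_X, ← mul_assoc]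
    exact (hG.mul_C a).mul_X_pow n

theorem summable_mul {G : PowerSeries ℤ} (hG : BoundedCoeff G) {f : ℕ → ℝ} (hf : Summable f) :
    Summable fun n => ((coeff n G : ℤ) : ℝ) * f n := by
  obtain ⟨C, hC⟩ := hG
  refine Summable.of_norm_bounded (g := fun n => C * ‖f n‖) (hf.norm.mul_left C) fun n => ?_
  rw [norm_mul]
  exact mul_le_mul_of_nonneg_right (hC n) (norm_nonneg _)

theorem tsum_X_sub_one_mul {G : PowerSeries ℤ} (hG : BoundedCoeff G) {f : ℕ → ℝ}
    (hf : Summable f) :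
    ∑' n, ((coeff n (G * (X - 1)) : ℤ) : ℝ) * f n = ∑' n, ((coeff n G : ℤ) : ℝ) * fwdDiff 1 f n := by
  have hf1 : Summable fun n => f (n + 1) := (summable_nat_add_iff 1).2 hf
  have hX := hG.mul_X_pow 1
  rw [pow_one] at hX
  have e1 : ∀ n, ((coeff n (G * (X - 1)) : ℤ) : ℝ) * f n =
      ((coeff n (G * X) : ℤ) : ℝ) * f n - ((coeff n G : ℤ) : ℝ) * f n := by
    intro n
    rw [mul_sub, mul_one, map_sub]; push_cast; ring
  have e2 : ∀ n, ((coeff n G : ℤ) : ℝ) * fwdDiff 1 f n =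
      ((coeff n G : ℤ) : ℝ) * f (n + 1) - ((coeff n G : ℤ) : ℝ) * f n := by
    intro n; rw [fwdDiff, mul_sub]
  simp only [e1, e2]
  rw [(hX.summable_mul hf).tsum_sub (hG.summable_mul hf),
    (hG.summable_mul hf1).tsum_sub (hG.summable_mul hf), (hX.summable_mul hf).tsum_eq_zero_add]
  simp [coeff_succ_mul_X]

theorem _root_.Summable.fwdDiff {f : ℕ → ℝ} (hf : Summable f) : Summable (fwdDiff 1 f) :=
  ((summable_nat_add_iff 1).2 hf).sub hf

theorem tsum_X_sub_one_pow_mul {G : PowerSeries ℤ} (hG : BoundedCoeff G) (K : ℕ) {f : ℕ → ℝ}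
    (hf : Summable f) :
    ∑' n, ((coeff n (G * (X - 1) ^ K) : ℤ) : ℝ) * f n = ∑' n, ((coeff n G : ℤ) : ℝ) * (fwdDiff 1)^[K] f n := by
  induction K generalizing f with
  | zero => simp
  | succ K ih =>
    have h : BoundedCoeff (G * (X - 1) ^ K) := by
      have := hG.mul_polynomial ((Polynomial.X - 1) ^ K)
      simpa using this
    rw [pow_succ, ← mul_assoc, h.tsum_X_sub_one_mul hf, ih hf.fwdDiff, Function.iterate_succ_apply]

end BoundedCoeff

-- Periodicity gives S (1 - X^M) = A with A(1) = 0; cancelling X - 1 gives SΦ = -Q.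
open PowerSeries in
theorem exists_pow_mul_mk_eq (M : ℕ) (χ : ℤ → ℤ) (hp : Function.Periodic χ (M : ℤ))
    (hm : ∑ x ∈ Finset.range M, χ (x : ℤ) = 0) (hχ : ∀ x, |χ x| ≤ 1) (K : ℕ) :
    ∃ (W : Polynomial ℤ) (G : PowerSeries ℤ), BoundedCoeff G ∧
      (C (M : ℤ)) ^ K * mk (fun n : ℕ => χ n) = (W : PowerSeries ℤ) + G * (X - 1) ^ K := by
  set S : PowerSeries ℤ := mk (fun n : ℕ => χ n) with hS
  have hSb : BoundedCoeff S := ⟨1, fun n => by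
    rw [hS, coeff_mk]; exact_mod_cast hχ n⟩
  let A : Polynomial ℤ := ∑ m ∈ Finset.range M, Polynomial.C (χ m) * Polynomial.X ^ m
  let Φ : Polynomial ℤ := ∑ m ∈ Finset.range M, Polynomial.X ^ m
  have hA : (Polynomial.X - 1) ∣ A := by
    rw [← Polynomial.C_1, Polynomial.dvd_iff_isRoot]
    simpa [A, Polynomial.IsRoot, Polynomial.eval_finsetSum] using hm
  obtain ⟨Q, hQ⟩ := hA
  have hΦ : (Polynomial.X - 1) ∣ Polynomial.C (M : ℤ) - Φ := by
    rw [← Polynomial.C_1, Polynomial.dvd_iff_isRoot]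
    simp [Φ, Polynomial.IsRoot, Polynomial.eval_finsetSum]
  obtain ⟨E, hE⟩ := hΦ
  have hAS : (A : PowerSeries ℤ) = S * (1 - X ^ M) := by
    ext n
    rw [mul_sub, mul_one, map_sub, coeff_mul_X_pow', Polynomial.coeff_coe]
    simp only [A, Polynomial.finsetSum_coeff, Polynomial.coeff_C_mul_X_pow, hS, coeff_mk]
    rw [Finset.sum_ite_eq]
    by_cases h : n < M
    · rw [if_pos (Finset.mem_range.2 h), if_neg (by omega), sub_zero]
    · rw [if_neg (by simpa using h), if_pos (by omega), Nat.cast_sub (by omega), hp.sub_eq, sub_self]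
  have hSΦ : S * (Φ : PowerSeries ℤ) = -(Q : PowerSeries ℤ) := by
    have h1 : (X - 1 : PowerSeries ℤ) ≠ 0 := by
      intro h
      have := congrArg (coeff 0) h
      simp at this
    apply mul_right_cancel₀ h1
    have h2 : Φ * (Polynomial.X - 1) = Polynomial.X ^ M - 1 := geom_sum_mul _ _
    have h3 := congrArg (fun P : Polynomial ℤ => (P : PowerSeries ℤ)) h2
    have h4 := congrArg (fun P : Polynomial ℤ => (P : PowerSeries ℤ)) hQ
    simp only [Polynomial.coe_mul, Polynomial.coe_sub, Polynomial.coe_X, Polynomial.coe_one,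
      Polynomial.coe_pow] at h3 h4
    linear_combination S * h3 + hAS - h4
  -- With M - Φ = (X - 1)E this reads M^K = (X - 1)^K E^K + ΦR; multiplying by S gives W = -QR and G
  -- = S E^K.
  obtain ⟨R, hR⟩ : Φ ∣ (Polynomial.C (M : ℤ)) ^ K - (Polynomial.C (M : ℤ) - Φ) ^ K := by
    have := sub_dvd_pow_sub_pow (Polynomial.C (M : ℤ)) (Polynomial.C (M : ℤ) - Φ) K
    rwa [sub_sub_cancel] at this
  rw [hE, mul_pow] at hR
  refine ⟨-(Q * R), S * ((E ^ K : Polynomial ℤ) : PowerSeries ℤ), hSb.mul_polynomial _, ?_⟩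
  have h5 := congrArg (fun P : Polynomial ℤ => (P : PowerSeries ℤ)) hR
  simp only [Polynomial.coe_mul, Polynomial.coe_sub, Polynomial.coe_X, Polynomial.coe_one,
    Polynomial.coe_pow, Polynomial.coe_C, Polynomial.coe_neg] at h5 ⊢
  linear_combination S * h5 + (R : PowerSeries ℤ) * hSΦ

/-! ### The expansion of the partial theta series -/

/-- Finite linear combinations of binomial coefficients, the shape of all coefficients
`H_{a,b,χ}(n)`. -/
noncomputable def binomialCombination (a b : ℤ) (D : ℕ) (W : Polynomial ℤ) (n : ℕ) : ℚ :=
  (-1) ^ n / D * ∑ j ∈ W.support, W.coeff j *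
    (((j : ℤ) : ℚ) * Ring.choose ((((j : ℤ) ^ 2 - a ^ 2 : ℤ) : ℚ) / b) n)

theorem partialTheta_exp_neg (a b : ℤ) (χ : ℤ → ℤ) (t : ℝ) :
    partialTheta a b χ (Real.exp (-t)) = ∑' n : ℕ, (χ n : ℝ) * thetaTerm a b t n := by
  unfold partialTheta thetaTerm
  refine tsum_congr fun n => ?_
  rw [← Real.exp_mul, neg_mul]
  ring

theorem binomialCombination_cast (a b : ℤ) (D : ℕ) (W : Polynomial ℤ) (n : ℕ) :
    (binomialCombination a b D W n : ℝ) = (D : ℝ)⁻¹ * ∑ j ∈ W.support, (W.coeff j : ℝ) *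
      (j * ((-1) ^ n * Ring.choose (((j : ℝ) ^ 2 - (a : ℝ) ^ 2) / b) n)) := by
  have h : ∀ y : ℚ, ((Ring.choose y n : ℚ) : ℝ) = Ring.choose (y : ℝ) n :=
    fun y => Ring.map_choose (Rat.castHom ℝ) y n
  unfold binomialCombination
  push_cast [h]
  rw [Finset.mul_sum, Finset.mul_sum]
  exact Finset.sum_congr rfl fun j _ => by ring

theorem isBigO_sub_binomialCombination (a b : ℤ) (hb : 0 < b) (M : ℕ) (hM : 0 < M) (χ : ℤ → ℤ)
    (hper : Function.Periodic χ (M : ℤ)) (hmean : ∑ x ∈ Finset.range M, χ (x : ℤ) = 0)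
    (hχ : ∀ x, |χ x| ≤ 1) (N : ℕ) :
    ∃ (k : ℕ) (W : Polynomial ℤ), (fun t : ℝ => partialTheta a b χ (Real.exp (-t)) -
      ∑ n ∈ Finset.range N, (binomialCombination a b (M ^ k) W n : ℝ) * (1 - Real.exp (-t)) ^ n)
      =O[𝓝[>] 0] fun t => t ^ N := by
  obtain ⟨W, G, ⟨C, hC⟩, hWG⟩ := exists_pow_mul_mk_eq M χ hper hmean hχ (2 * N + 3)
  refine ⟨2 * N + 3, W, ?_⟩
  obtain ⟨C', hC'⟩ := tsum_abs_thetaTerm_fwdDiff_le a b hb N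
  have hMR : (M : ℝ) ≠ 0 := by positivity
  have hrem : (fun t : ℝ => ∑' n : ℕ, ((PowerSeries.coeff n G : ℤ) : ℝ) *
      (fwdDiff 1)^[2 * N + 3] (fun m : ℕ => thetaTerm a b t m) n) =O[𝓝[>] 0] fun t => t ^ N := by
    refine IsBigO.of_bound (C * C') ?_
    filter_upwards [Ioc_mem_nhdsGT (zero_lt_one' ℝ)] with t ht
    rw [Real.norm_eq_abs, norm_pow, Real.norm_of_nonneg ht.1.le, mul_assoc]
    exact hC' t ht.1 ht.2 C _ hC
  have hmain : (fun t : ℝ => ∑ j ∈ W.support, (W.coeff j : ℝ) * (j *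
      (Real.exp (-(t * (((j : ℝ) ^ 2 - (a : ℝ) ^ 2) / b))) - ∑ n ∈ Finset.range N,
        (-1) ^ n * Ring.choose (((j : ℝ) ^ 2 - (a : ℝ) ^ 2) / b) n * (1 - Real.exp (-t)) ^ n)))
      =O[𝓝[>] 0] fun t => t ^ N :=
    IsBigO.fun_sum fun j _ => ((exp_neg_mul_sub_binomial_isBigO _ N).const_mul_left _).const_mul_left _
  refine ((hmain.add hrem).const_mul_left (((M ^ (2 * N + 3) : ℕ) : ℝ)⁻¹)).congr' ?_ EventuallyEq.rfl
  filter_upwards [Ioc_mem_nhdsGT (zero_lt_one' ℝ)] with t ht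
  have hs := thetaTerm_summable a b hb t ht.1 ht.2
  have hGX : BoundedCoeff (G * (PowerSeries.X - 1) ^ (2 * N + 3)) := by
    have := BoundedCoeff.mul_polynomial ⟨C, hC⟩ ((Polynomial.X - 1) ^ (2 * N + 3))
    simpa using this
  have hcoef : ∀ n : ℕ, ((M : ℝ) ^ (2 * N + 3)) * ((χ n : ℝ) * thetaTerm a b t n) =
      (W.coeff n : ℝ) * thetaTerm a b t n +
      ((PowerSeries.coeff n (G * (PowerSeries.X - 1) ^ (2 * N + 3)) : ℤ) : ℝ) *
        thetaTerm a b t n := by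
    intro n
    have h := congrArg (PowerSeries.coeff n) hWG
    rw [← map_pow, PowerSeries.coeff_C_mul, PowerSeries.coeff_mk, map_add,
      Polynomial.coeff_coe] at h
    have h' := congrArg (Int.cast : ℤ → ℝ) h
    push_cast at h'
    linear_combination thetaTerm a b t n * h'
  have hW : ∀ n ∉ W.support, (W.coeff n : ℝ) * thetaTerm a b t n = 0 := by
    intro n hn
    rw [Polynomial.notMem_support_iff.1 hn]; simp
  have htot : ((M : ℝ) ^ (2 * N + 3)) * partialTheta a b χ (Real.exp (-t)) =
      ∑ j ∈ W.support, (W.coeff j : ℝ) * thetaTerm a b t j +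
      ∑' n : ℕ, ((PowerSeries.coeff n G : ℤ) : ℝ) *
        (fwdDiff 1)^[2 * N + 3] (fun m : ℕ => thetaTerm a b t m) n := by
    rw [partialTheta_exp_neg, ← tsum_mul_left, tsum_congr hcoef,
      (summable_of_ne_finset_zero hW).tsum_add (hGX.summable_mul hs), tsum_eq_sum hW,
      BoundedCoeff.tsum_X_sub_one_pow_mul ⟨C, hC⟩ _ hs]
  have hP : partialTheta a b χ (Real.exp (-t)) = ((M : ℝ) ^ (2 * N + 3))⁻¹ *
      (∑ j ∈ W.support, (W.coeff j : ℝ) * thetaTerm a b t j +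
      ∑' n : ℕ, ((PowerSeries.coeff n G : ℤ) : ℝ) *
        (fwdDiff 1)^[2 * N + 3] (fun m : ℕ => thetaTerm a b t m) n) := by
    rw [← htot]; field_simp
  have hfin : ∑ n ∈ Finset.range N,
      (binomialCombination a b (M ^ (2 * N + 3)) W n : ℝ) * (1 - Real.exp (-t)) ^ n =
      ((M : ℝ) ^ (2 * N + 3))⁻¹ * ∑ j ∈ W.support, (W.coeff j : ℝ) * (j *
        ∑ n ∈ Finset.range N, (-1) ^ n * Ring.choose (((j : ℝ) ^ 2 - (a : ℝ) ^ 2) / b) n *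
          (1 - Real.exp (-t)) ^ n) := by
    simp only [binomialCombination_cast, Finset.mul_sum, Finset.sum_mul]
    rw [Finset.sum_comm]
    refine Finset.sum_congr rfl fun j _ => Finset.sum_congr rfl fun n _ => ?_
    push_cast; ring
  rw [hP, hfin, Nat.cast_pow, add_comm _ (tsum _), mul_add, mul_add, add_comm (_ * tsum _),
    add_sub_right_comm, ← mul_sub, ← Finset.sum_sub_distrib]
  congr 2
  refine Finset.sum_congr rfl fun j _ => ?_
  simp only [thetaTerm]; ring

theorem pow_isBigO_pow_of_le {m n : ℕ} (h : m ≤ n) :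
    (fun t : ℝ => t ^ n) =O[𝓝[>] 0] fun t => t ^ m := by
  refine IsBigO.of_bound 1 ?_
  filter_upwards [Ioc_mem_nhdsGT (zero_lt_one' ℝ)] with t ht
  rw [one_mul, norm_pow, norm_pow, Real.norm_of_nonneg ht.1.le]
  exact pow_le_pow_of_le_one ht.1.le ht.2 h

theorem isBigO_sub_sum_of_le {f : ℝ → ℝ} {c : ℕ → ℝ} {m n : ℕ} (hmn : m ≤ n)
    (h : (fun t : ℝ => f t - ∑ k ∈ Finset.range n, c k * (1 - Real.exp (-t)) ^ k)
      =O[𝓝[>] 0] fun t => t ^ n) :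
    (fun t : ℝ => f t - ∑ k ∈ Finset.range m, c k * (1 - Real.exp (-t)) ^ k)
      =O[𝓝[>] 0] fun t => t ^ m := by
  have h1 := h.trans (pow_isBigO_pow_of_le hmn)
  have h2 : (fun t : ℝ => ∑ k ∈ Finset.Ico m n, c k * (1 - Real.exp (-t)) ^ k)
      =O[𝓝[>] 0] fun t => t ^ m :=
    IsBigO.fun_sum fun k hk => ((one_sub_exp_neg_isTheta.1.pow k).const_mul_left _).trans
      (pow_isBigO_pow_of_le (Finset.mem_Ico.1 hk).1)
  refine (h1.add h2).congr_left fun t => ?_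
  rw [← Finset.sum_range_add_sum_Ico _ hmn]; ring

theorem coeff_eq_of_isBigO {f : ℝ → ℝ} {c d : ℕ → ℝ} {N : ℕ}
    (hc : (fun t : ℝ => f t - ∑ k ∈ Finset.range N, c k * (1 - Real.exp (-t)) ^ k)
      =O[𝓝[>] 0] fun t => t ^ N)
    (hd : (fun t : ℝ => f t - ∑ k ∈ Finset.range N, d k * (1 - Real.exp (-t)) ^ k)
      =O[𝓝[>] 0] fun t => t ^ N) : ∀ n < N, c n = d n := by
  have hw0 : ∀ᶠ t : ℝ in 𝓝[>] 0, 1 - Real.exp (-t) ≠ 0 := by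
    filter_upwards [self_mem_nhdsWithin] with t ht
    have : Real.exp (-t) < 1 := by rw [Real.exp_lt_one_iff]; exact neg_lt_zero.2 ht
    linarith
  have h := eq_zero_of_sum_mul_pow_isBigO one_sub_exp_neg_tendsto hw0 N (fun n => c n - d n) (by
    refine ((hd.sub hc).trans (one_sub_exp_neg_isTheta.2.pow N)).congr_left fun t => ?_
    simp only [sub_mul, Finset.sum_sub_distrib]; ring)
  exact fun n hn => sub_eq_zero.1 (h n hn)

theorem HasExpansion.iff_eq {a b : ℤ} {χ : ℤ → ℤ} {H : ℕ → ℝ} (h : HasExpansion a b χ H)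
    (c : ℕ → ℝ) : HasExpansion a b χ c ↔ ∀ n, c n = H n := by
  refine ⟨fun hc n => coeff_eq_of_isBigO (hc (n + 1)) (h (n + 1)) n n.lt_succ_self, fun hc => ?_⟩
  rwa [funext hc]

theorem exists_hasExpansion (a b : ℤ) (hb : 0 < b) (M : ℕ) (hM : 0 < M) (χ : ℤ → ℤ)
    (hper : Function.Periodic χ (M : ℤ)) (hmean : ∑ x ∈ Finset.range M, χ (x : ℤ) = 0)
    (hχ : ∀ x, |χ x| ≤ 1) :
    ∃ H : ℕ → ℚ, HasExpansion a b χ (fun n => (H n : ℝ)) ∧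
      ∀ n, ∃ (k : ℕ) (W : Polynomial ℤ), H n = binomialCombination a b (M ^ k) W n := by
  choose k W hW using isBigO_sub_binomialCombination a b hb M hM χ hper hmean hχ
  -- W and k depend on the order N. Order n + 1 is the first to determine coefficient n, and
  -- uniqueness makes higher orders agree with it.
  refine ⟨fun n => binomialCombination a b (M ^ k (n + 1)) (W (n + 1)) n, fun N => ?_,
    fun n => ⟨_, _, rfl⟩⟩
  refine (hW N).congr_left fun t => ?_
  congr 1
  refine Finset.sum_congr rfl fun n hn => ?_
  have hn' : n + 1 ≤ N := Finset.mem_range.1 hn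
  congr 1
  exact coeff_eq_of_isBigO (isBigO_sub_sum_of_le hn' (hW N)) (hW (n + 1)) n n.lt_succ_self

/-! ### Residues modulo p and the support of χ -/

theorem PartialThetaIntegral.exists_mul_eq {a b : ℤ} {χ : ℤ → ℤ} (hb : b ≠ 0)
    (hP : PartialThetaIntegral a b χ) {x : ℕ} (hx : 0 < x) (hχ : χ x ≠ 0) :
    ∃ k : ℕ, b * k = (x : ℤ) ^ 2 - a ^ 2 := by
  have hbQ : (b : ℚ) ≠ 0 := by exact_mod_cast hb
  have hc : partialThetaCoeff a b χ (((x : ℚ) ^ 2 - (a : ℚ) ^ 2) / b) = x * χ x := by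
    unfold partialThetaCoeff
    rw [finsum_eq_single _ x]
    · simp
    · intro n hn
      have : ¬ ((n : ℚ) ^ 2 - (a : ℚ) ^ 2) / b = ((x : ℚ) ^ 2 - (a : ℚ) ^ 2) / b := by
        rw [div_left_inj' hbQ, sub_left_inj]
        intro h
        have h' : n ^ 2 = x ^ 2 := by exact_mod_cast h
        exact hn (Nat.pow_left_injective two_ne_zero h')
      simp [this]
  obtain ⟨k, hk⟩ := hP _ (by
    rw [hc]; exact mul_ne_zero (by exact_mod_cast hx.ne') hχ)
  refine ⟨k, ?_⟩
  rw [div_eq_iff hbQ] at hk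
  have : ((b * k : ℤ) : ℚ) = (((x : ℤ) ^ 2 - a ^ 2 : ℤ) : ℚ) := by
    push_cast; rw [hk]; ring
  exact_mod_cast this

theorem exists_modEq_and_ne_zero {M p : ℕ} (hpM : Nat.Coprime p M) (hM : 0 < M) (hp : 0 < p)
    {χ : ℤ → ℤ} (hper : Function.Periodic χ (M : ℤ)) {x₀ : ℤ} (hx₀ : χ x₀ ≠ 0) (j a : ℤ) :
    ∃ x : ℕ, |a| < x ∧ χ x ≠ 0 ∧ (x : ℤ) ≡ j [ZMOD p] := by
  obtain ⟨u, v, huv⟩ := Nat.isCoprime_iff_coprime.2 hpM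
  -- Chinese remaindering: z ≡ x₀ mod M and z ≡ j mod p. Adding pML keeps both classes and exceeds
  -- |a|.
  set z : ℤ := x₀ * (u * p) + j * (v * M) with hz
  set L : ℤ := |z| + |a| + 1 with hL
  have hpM1 : (1 : ℤ) ≤ (p : ℤ) * M := by exact_mod_cast Nat.mul_pos hp hM
  have hbig : |a| < z + (p * M) * L := by
    have h1 := neg_abs_le z
    have h2 : (0 : ℤ) ≤ L := by positivity
    nlinarith [abs_nonneg a]
  have hnn : 0 ≤ z + (p * M) * L := (abs_nonneg a).trans hbig.le
  refine ⟨(z + (p * M) * L).toNat, ?_, ?_, ?_⟩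
  · rwa [Int.toNat_of_nonneg hnn]
  · rw [Int.toNat_of_nonneg hnn]
    have : z + (p * M) * L = x₀ + ((j - x₀) * v + p * L) * M := by
      rw [hz]; linear_combination x₀ * huv
    have hq := hper.int_mul ((j - x₀) * v + p * L) x₀
    rw [Int.cast_id] at hq
    rwa [this, hq]
  · rw [Int.toNat_of_nonneg hnn, Int.modEq_iff_dvd]
    refine ⟨(j - x₀) * u - M * L, ?_⟩
    rw [hz]; linear_combination (-j) * huv

theorem not_dvd_add_mul_of_le_sub_sSup {p : ℕ} (hp : p.Prime) {S : Set ℕ} (hS : ∀ s ∈ S, s < p)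
    {b k u : ℤ} (hb : ¬ (p : ℤ) ∣ b) (hk : (p : ℤ) ∣ u - b * k) {s : ℕ} (hs : s ∈ S)
    (hks : k ≡ s [ZMOD p]) {B : ℕ} (hB : B ≤ p - 1 - sSup S) {i : ℕ} (hi : 0 < i) (hiB : i ≤ B) :
    ¬ (p : ℤ) ∣ u + b * i := by
  -- Boundedness matters: `sSup` of an unbounded set of naturals is 0.
  have hle : s ≤ sSup S := le_csSup ⟨p, fun s hs => (hS s hs).le⟩ hs
  intro h
  have h1 : (p : ℤ) ∣ b * (k + i) := by
    have := dvd_sub h hk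
    rwa [show u + b * i - (u - b * k) = b * (k + i) by ring] at this
  have h2 := ((Nat.prime_iff_prime_int.1 hp).dvd_or_dvd h1).resolve_left hb
  have h3 : (p : ℤ) ∣ ((s + i : ℕ) : ℤ) := by
    have := dvd_add h2 (Int.modEq_iff_dvd.1 hks)
    rwa [show k + i + (s - k) = ((s + i : ℕ) : ℤ) by push_cast; ring] at this
  have h4 := Nat.le_of_dvd (by omega) (Int.natCast_dvd_natCast.1 h3)
  omega

theorem exists_unique_dvd_of_betaDigit_ne {p : ℕ} (hp : p.Prime) {a b j : ℤ}
    (hb : ¬ (p : ℤ) ∣ b) (hβ : betaDigit p a b ≠ p - 1) (hj : (p : ℤ) ∣ j) :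
    ∃ i₀ : ℕ, (∀ i : ℕ, 0 < i → i < p → i ≠ i₀ → ¬ (p : ℤ) ∣ j ^ 2 - a ^ 2 + b * i) ∧
      ¬ (p : ℤ) ^ 2 ∣ j ^ 2 - a ^ 2 + b * i₀ := by
  have hpp := Nat.prime_iff_prime_int.1 hp
  have : NeZero (p ^ 2) := ⟨pow_ne_zero 2 hp.ne_zero⟩
  have hcop : IsCoprime ((p : ℤ) ^ 2) b :=
    ((Prime.coprime_iff_not_dvd hpp).2 hb).pow_left
  set m : ℕ := (-(a : ZMod (p ^ 2)) ^ 2 * (b : ZMod (p ^ 2))⁻¹).val with hm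
  have hmβ : m / p ≠ p - 1 := hβ
  have hmlt : m < p * p := by
    have := ZMod.val_lt (-(a : ZMod (p ^ 2)) ^ 2 * (b : ZMod (p ^ 2))⁻¹)
    rwa [← sq]
  have hbm : (p : ℤ) ^ 2 ∣ b * m + a ^ 2 := by
    have hbu : (b : ZMod (p ^ 2)) * (b : ZMod (p ^ 2))⁻¹ = 1 := by
      apply ZMod.coe_int_mul_inv_eq_one
      rw [Nat.cast_pow]; exact hcop.symm
    have : ((b * m + a ^ 2 : ℤ) : ZMod (p ^ 2)) = 0 := by
      push_cast
      rw [hm, ZMod.natCast_zmod_val]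
      linear_combination (-(a : ZMod (p ^ 2)) ^ 2) * hbu
    rw [ZMod.intCast_zmod_eq_zero_iff_dvd] at this
    exact_mod_cast this
  have hcong : ∀ i : ℕ, (p : ℤ) ^ 2 ∣ (j ^ 2 - a ^ 2 + b * i) - b * ((m + i : ℕ) : ℤ) := by
    intro i
    have e : (j ^ 2 - a ^ 2 + b * i) - b * ((m + i : ℕ) : ℤ) = j ^ 2 - (b * m + a ^ 2) := by
      push_cast; ring
    rw [e]
    exact dvd_sub (pow_dvd_pow_of_dvd hj 2) hbm
  have hdm := Nat.div_add_mod m p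
  have hml : m % p < p := Nat.mod_lt _ hp.pos
  -- Modulo p^2, y ≡ m = d₀ + βp. Adding i₀ = p - d₀ gives p(β + 1), and β + 1 < p. If d₀ = 0 then
  -- i₀ = p, beyond the range of i.
  refine ⟨p - m % p, ?_, ?_⟩
  · intro i hi hip hne h
    have h1 := dvd_sub h ((dvd_pow_self (p : ℤ) two_ne_zero).trans (hcong i))
    rw [sub_sub_cancel] at h1
    have h2 := Int.natCast_dvd_natCast.1 ((hpp.dvd_or_dvd h1).resolve_left hb)
    have h3 : p ∣ m % p + i := by
      rw [Nat.dvd_iff_mod_eq_zero] at h2 ⊢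
      rwa [Nat.mod_add_mod]
    obtain ⟨c, hc⟩ := h3
    have hc2 : c < 2 := by
      by_contra hcon
      have : p * 2 ≤ p * c := Nat.mul_le_mul_left p (by omega)
      omega
    interval_cases c <;> omega
  · intro h
    have h1 := dvd_sub h (hcong (p - m % p))
    rw [sub_sub_cancel] at h1
    have h2 := hcop.dvd_of_dvd_mul_left h1
    have h3 : p ^ 2 ∣ m + (p - m % p) := by exact_mod_cast h2
    have h4 : m + (p - m % p) = p * (m / p + 1) := by
      rw [mul_add, mul_one]; omega
    rw [h4, sq] at h3
    have h5 := Nat.le_of_dvd (Nat.succ_pos _) (Nat.dvd_of_mul_dvd_mul_left hp.pos h3)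
    have h6 := Nat.div_lt_of_lt_mul hmlt
    omega

theorem CongrZero.binomialCombination {p : ℕ} (hp : p.Prime) {a b : ℤ} (hb : ¬ (p : ℤ) ∣ b)
    {M : ℕ} (hpM : Nat.Coprime p M) (k : ℕ) (W : Polynomial ℤ) {n A B : ℕ} (hn : 0 < n)
    (hA : 0 < A) (hB : 0 < B) (hBp : B < p)
    (h : ∀ j : ℤ, (∀ i : ℕ, 0 < i → i ≤ B → ¬ (p : ℤ) ∣ j ^ 2 - a ^ 2 + b * i) ∨
      ((p : ℤ) ∣ j ∧ ∃ i₀ : ℕ,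
        (∀ i : ℕ, 0 < i → i ≤ B → i ≠ i₀ → ¬ (p : ℤ) ∣ j ^ 2 - a ^ 2 + b * i) ∧
        ¬ (p : ℤ) ^ 2 ∣ j ^ 2 - a ^ 2 + b * i₀)) :
    CongrZero p A (binomialCombination a b (M ^ k) W (p ^ A * n - B)) := by
  have : Fact p.Prime := ⟨hp⟩
  have hle : B ≤ p ^ A * n :=
    hBp.le.trans ((Nat.le_self_pow hA.ne' p).trans (Nat.le_mul_of_pos_right _ hn))
  exact CongrZero.sum_choose W.support b hb (fun j => (j : ℤ) ^ 2 - a ^ 2) (fun j => (j : ℤ))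
    W.coeff _ A (M ^ k) (hpM.pow_right k) fun j _ y hy =>
      PadicInt.pow_dvd_mul_choose_of_int hb hy (j : ℤ) A n B hB hle (h j)

theorem congrZero_zero {p : ℕ} (hp : p.Prime) (A : ℕ) : CongrZero p A 0 :=
  ⟨0, 1, fun h => hp.one_lt.ne' (by exact_mod_cast Int.eq_one_of_dvd_one (by positivity) h),
    by simp⟩

/-- `H` is the sequence of coefficients `H_{a,b,χ}(n)`, and its defining property (existence and
uniqueness of the expansion, with rational coefficients) is part of the conclusion. -/
theorem theorem3p3 (M : ℕ) (χ : ℤ → ℤ) (hχ : IsGood M χ)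
    (p : ℕ) (hp : p.Prime) (hpM : Nat.Coprime p M)
    (a b : ℤ) (hb : b ≠ 0) (hP : PartialThetaIntegral a b χ) :
    ∃ H : ℕ → ℚ,
      (∀ c : ℕ → ℝ, HasExpansion a b χ c ↔ ∀ n, c n = (H n : ℝ)) ∧
      (∀ B ∈ Finset.Icc 1 (p - 1 - sSup (residuesStar a b χ p)),
        ∀ n A : ℕ, 0 < n → 0 < A → CongrZero p A (H (p ^ A * n - B))) ∧
      (betaDigit p a b ≠ p - 1 → IsCoprime b (p : ℤ) →
        ∀ B ∈ Finset.Icc 1 (p - 1 - sSup (residues a b χ p)),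
          ∀ n A : ℕ, 0 < n → 0 < A → CongrZero p A (H (p ^ A * n - B))) := by
  -- For χ = 0 integrality says nothing about b, and every coefficient vanishes.
  by_cases hχ0 : ∀ x, χ x = 0
  · have h0 : HasExpansion a b χ (fun n => (((fun _ => 0 : ℕ → ℚ) n : ℚ) : ℝ)) := fun N => by
      simp [partialTheta, hχ0, isBigO_zero]
    exact ⟨fun _ => 0, h0.iff_eq, fun _ _ _ A _ _ => congrZero_zero hp A,
      fun _ _ _ _ _ A _ _ => congrZero_zero hp A⟩
  push Not at hχ0
  obtain ⟨x₀, hx₀⟩ := hχ0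
  have hsupp := exists_modEq_and_ne_zero hpM hχ.period_pos hp.pos hχ.periodic hx₀
  have hpos : ∀ {x : ℕ}, |a| < x → 0 < x := fun h => by
    exact_mod_cast (abs_nonneg a).trans_lt h
  -- A support point x > |a| has a nonnegative exponent and x^2 - a^2 > 0.
  have hb0 : 0 < b := by
    obtain ⟨x, hxa, hx, -⟩ := hsupp 0 a
    obtain ⟨k, hk⟩ := hP.exists_mul_eq hb (hpos hxa) hx
    have h1 : 0 < b * k := by
      rw [hk, sub_pos, sq_lt_sq, abs_of_nonneg (Int.natCast_nonneg x)]
      exact hxa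
    exact pos_of_mul_pos_left h1 (Int.natCast_nonneg k)
  -- Support points x ≡ 0 and y ≡ 1 mod p give b ∣ y^2 - x^2 ≡ 1 mod p.
  have hpb : ¬ (p : ℤ) ∣ b := by
    intro h
    obtain ⟨x, hxa, hx, hx0⟩ := hsupp 0 a
    obtain ⟨y, hya, hy, hy1⟩ := hsupp 1 a
    obtain ⟨k, hk⟩ := hP.exists_mul_eq hb (hpos hxa) hx
    obtain ⟨l, hl⟩ := hP.exists_mul_eq hb (hpos hya) hy
    have h1 : (y : ℤ) ^ 2 - (x : ℤ) ^ 2 ≡ 1 ^ 2 - 0 ^ 2 [ZMOD p] := (hy1.pow 2).sub (hx0.pow 2)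
    have h2 : (p : ℤ) ∣ (y : ℤ) ^ 2 - (x : ℤ) ^ 2 := by
      rw [show (y : ℤ) ^ 2 - (x : ℤ) ^ 2 = b * (l - k) by rw [mul_sub, hk, hl]; ring]
      exact h.mul_right _
    have h3 : (p : ℤ) ∣ 1 := by
      have := (Int.modEq_zero_iff_dvd.2 h2).symm.trans h1
      simpa using (Int.modEq_iff_dvd.1 this)
    exact (Nat.prime_iff_prime_int.1 hp).not_dvd_one h3
  obtain ⟨H, hH, hHW⟩ := exists_hasExpansion a b hb0 M hχ.period_pos χ hχ.periodic hχ.mean_zero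
    fun x => by rcases hχ.values x with h | h | h <;> simp [h]
  -- The indices j of W need not lie in the support of χ; each is replaced by a support point x ≡ j
  -- mod p.
  have hres : ∀ j : ℤ, ∃ (x : ℕ) (k : ℤ), χ x ≠ 0 ∧ (x : ℤ) ≡ j [ZMOD p] ∧
      b * k = (x : ℤ) ^ 2 - a ^ 2 ∧ (p : ℤ) ∣ (j ^ 2 - a ^ 2) - b * k ∧
      (k % p).toNat < p ∧ k ≡ (k % p).toNat [ZMOD p] := by
    intro j
    obtain ⟨x, hxa, hx, hxj⟩ := hsupp j a
    obtain ⟨k, hk⟩ := hP.exists_mul_eq hb (hpos hxa) hx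
    have hp0 : (0 : ℤ) < p := by exact_mod_cast hp.pos
    have hnn := Int.emod_nonneg (k : ℤ) hp0.ne'
    refine ⟨x, k, hx, hxj, hk, ?_, ?_, ?_⟩
    · rw [hk]
      exact Int.modEq_iff_dvd.1 ((hxj.pow 2).sub (Int.ModEq.refl _))
    · have := Int.emod_lt_of_pos (k : ℤ) hp0
      omega
    · rw [Int.toNat_of_nonneg hnn]
      exact (Int.mod_modEq _ _).symm
  refine ⟨H, hH.iff_eq, fun B hB n A hn hA => ?_, fun hβ _ B hB n A hn hA => ?_⟩
  · rw [Finset.mem_Icc] at hB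
    obtain ⟨k, W, hW⟩ := hHW (p ^ A * n - B)
    rw [hW]
    refine CongrZero.binomialCombination hp hpb hpM k W hn hA hB.1 (by omega) fun j => Or.inl ?_
    intro i hi hiB
    obtain ⟨x, k, hx, -, hk, hjk, hlt, hmod⟩ := hres j
    exact not_dvd_add_mul_of_le_sub_sSup hp (fun s hs => hs.1) hpb hjk
      (⟨hlt, x, hx, k, hk, hmod⟩ : (k % p).toNat ∈ residuesStar a b χ p) hmod hB.2 hi hiB
  · rw [Finset.mem_Icc] at hB
    obtain ⟨k, W, hW⟩ := hHW (p ^ A * n - B)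
    rw [hW]
    refine CongrZero.binomialCombination hp hpb hpM k W hn hA hB.1 (by omega) fun j => ?_
    by_cases hj : (p : ℤ) ∣ j
    · obtain ⟨i₀, h1, h2⟩ := exists_unique_dvd_of_betaDigit_ne hp hpb hβ hj
      exact Or.inr ⟨hj, i₀, fun i hi hiB => h1 i hi (by omega), h2⟩
    · refine Or.inl fun i hi hiB => ?_
      obtain ⟨x, k, hx, hxj, hk, hjk, hlt, hmod⟩ := hres j
      have hx0 : ¬ ((x : ℤ) ≡ 0 [ZMOD p]) := fun h =>
        hj (Int.modEq_zero_iff_dvd.1 (hxj.symm.trans h))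
      exact not_dvd_add_mul_of_le_sub_sSup hp (fun s hs => hs.1) hpb hjk
        (⟨hlt, x, hx, hx0, k, hk, hmod⟩ : (k % p).toNat ∈ residues a b χ p) hmod hB.2 hi hiB
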